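/- Let $|\cdot|$ be a fixed norm on $\mathbb{R}^d$, let $\Omega\subseteq\mathbb{R}^d$ be an open convex neighbourhood of $0$, let $\Lambda\subseteq\mathbb{R}$ be an open interval, and let $f_t:\Omega\times\Lambda\to\mathbb{R}^d$, $t\in\mathbb{Z}$, be continuous mappings such that: * $(H_0)$ for every compact $K\subset\mathbb{R}^d\times\mathbb{R}$ one has $\sup_{t\in\mathbb{Z}}\sup_{(x,\lambda)\in K\cap(\Omega\times\Lambda)}|f_t(x,\lambda)|<\infty$; * $(H_1)$ for every $\varepsilon>0$ and compact $K\subset\mathbb{R}^d\times\mathbb{R}$ there is a $\delta>0$ such that $\max\{|x_2-x_1|,|\lambda_2-\lambda_1|\}<\delta$ implies $\sup_{t\in\mathbb{Z}}|f_t(x_2,\lambda_2)-f_t(x_1,\lambda_1)|<\varepsilon$ for all $(x_1,\lambda_1),(x_2,\lambda_2)\in K\cap(\Omega\times\Lambda)$; * $(H_2)$ the partial derivatives $D_1f_t:\Omega\times\Lambda\to L(\mathbb{R}^d)$ exist and are continuous; for every $\lambda\in\Lambda$ and every bounded $B\subseteq\Omega$ one has $\sup_{t\in\mathbb{Z}}\sup_{x\in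 B}|D_1f_t(x,\lambda)|<\infty$; and for every $\varepsilon>0$ and $\lambda_0\in\Lambda$ there is a $\delta>0$ such that $|x_2-x_1|<\delta$ implies $\sup_{t\in\mathbb{Z}}|D_1f_t(x_2,\lambda)-D_1f_t(x_1,\lambda_0)|<\varepsilon$ for all $x_1,x_2\in\Omega$ and all $\lambda\in\Lambda$ with $|\lambda-\lambda_0|<\delta$; * $(H_3)$ $\lim_{t\to\pm\infty}f_t(0,\lambda)=0$ for all $\lambda\in\Lambda$. Let $\ell_0$ be the Banach space of sequences $\phi=(\phi_t)_{t\in\mathbb{Z}}$ in $\mathbb{R}^d$ with $\lim_{t\to\pm\infty}\phi_t=0$ and norm $\|\phi\|=\sup_{t}|\phi_t|$, and let $\ell_0(\Omega)$ be the set of $\phi\in\ell_0$ with $\phi_t\in\Omega$ for all $t$. Let $\lambda^\ast\in\Lambda$ and let $\phi^\ast\in\ell_0(\Omega)$ satisfy $\phi^\ast_{t+1}=f_t(\phi^\ast_t,\lambda^\ast)$ for all $t\in\mathbb{Z}$. Define $$\mathcal{G}:\ell_0(\Omega)\times\Lambda\to\ell_0,\qquad \mathcal{G}(\phi,\lambda)_t=\phi_{t+1}-f_t(\phi_t,\lambda).$$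 A linear equation $x_{t+1}=A_tx_t$ with $A_t\in L(\mathbb{R}^d)$, $t\in\mathbb{Z}$, and $\Phi(t,s)=A_{t-1}\cdots A_s$ for $s\le t$ (so that $\Phi(s,s)=I$), has an exponential dichotomy on $\mathbb{Z}$ if there are projections $P_t\in L(\mathbb{R}^d)$ such that, for all $t\in\mathbb{Z}$, $P_{t+1}A_t=A_tP_t$ and $A_t$ maps the kernel $N(P_t)$ bijectively onto $N(P_{t+1})$, and reals $K\ge1$, $\alpha\in(0,1)$ with $$|\Phi(t,s)P_s|\le K\alpha^{t-s},\qquad |\bar\Phi(s,t)(I-P_t)|\le K\alpha^{t-s}\qquad\text{for all }s\le t,$$ where $\bar\Phi(s,t):N(P_t)\to N(P_s)$ is the inverse of $\Phi(t,s)|_{N(P_s)}$. Let $\Sigma(\lambda^\ast)$ be the set of all $\gamma>0$ for which $x_{t+1}=\gamma^{-1}D_1f_t(\phi^\ast_t,\lambda^\ast)x_t$ has no exponential dichotomy on $\mathbb{Z}$. Then for all $\phi\in\ell_0(\Omega)$ and $\lambda\in\Lambda$ the partial Fréchet derivative $D_1\mathcal{G}(\phi,\lambda)\in L(\ell_0)$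 exists and is given by $(D_1\mathcal{G}(\phi,\lambda)\psi)_t=\psi_{t+1}-D_1f_t(\phi_t,\lambda)\psi_t$, and moreover: (a) $D_1\mathcal{G}(\phi^\ast,\lambda^\ast)$ is invertible in $L(\ell_0)$ if and only if $1\notin\Sigma(\lambda^\ast)$; (b) if $1\notin\Sigma(\lambda^\ast)$, then $D_1\mathcal{G}(\phi,\lambda^\ast)$ is a Fredholm operator of index $0$ for every $\phi\in\ell_0(\Omega)$; (c) for all $\phi\in\ell_0(\Omega)$ and $\lambda\in\Lambda$, $D_1\mathcal{G}(\phi^\ast,\lambda)$ is Fredholm of index $0$ if and only if $D_1\mathcal{G}(\phi,\lambda)$ is. -/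

import Mathlib

open scoped Topology ZeroAtInfty
open Filter Set

noncomputable section

namespace HomoclinicDE

variable {E : Type*} [NormedAddCommGroup E] [NormedSpace ℝ E]

/-! ### Linear difference equations, exponential dichotomies, dichotomy spectrum -/

/-- The evolution operator `Φ(s + n, s) = A_{s+n-1} ⋯ A_s` of `x_{t+1} = A_t x_t`, where `n ≥ 0`. -/
def evolution (A : ℤ → E →L[ℝ] E) (s : ℤ) : ℕ → E →L[ℝ] E
  | 0 => ContinuousLinearMap.id ℝ E
  | n + 1 => (A (s + n)).comp (evolution A s n)

/-- `(P_t)` is an invariant projector on `ℤ` of `x_{t+1} = A_t x_t`: each `P_t` is a projection,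
`P_{t+1} A_t = A_t P_t`, and `A_t` maps the kernel of `P_t` bijectively onto that of `P_{t+1}`. -/
structure IsInvariantProjector (A P : ℤ → E →L[ℝ] E) : Prop where
  idem : ∀ t, (P t).comp (P t) = P t
  comm : ∀ t, (P (t + 1)).comp (A t) = (A t).comp (P t)
  bijOn_ker : ∀ t, BijOn (A t) {x | P t x = 0} {x | P (t + 1) x = 0}

/-- The equation `x_{t+1} = A_t x_t` has an exponential dichotomy on `ℤ`.
Put `t = s + n`. The first estimate is `|Φ(t,s) P_s| ≤ K α^(t-s)`. The second one is
`|Φ̄(s,t) (I - P_t)| ≤ K α^(t-s)`, where `Φ̄(s,t)` is the inverse of the bijection `Φ(t,s) : N(P_s) → N(P_t)`, so that `x = Φ̄(s,t) (I - P_t) y` means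
`P_s x = 0` and `Φ(t,s) x = y - P_t y`. -/
def HasExpDichotomy (A : ℤ → E →L[ℝ] E) : Prop :=
  ∃ P : ℤ → E →L[ℝ] E, IsInvariantProjector A P ∧
    ∃ K α : ℝ, 1 ≤ K ∧ 0 < α ∧ α < 1 ∧
      (∀ (s : ℤ) (n : ℕ), ‖(evolution A s n).comp (P s)‖ ≤ K * α ^ n) ∧
      (∀ (s : ℤ) (n : ℕ) (x y : E), P s x = 0 → evolution A s n x = y - P (s + n) y →
        ‖x‖ ≤ K * α ^ n * ‖y‖)

/-- The (all time) dichotomy spectrum of `x_{t+1} = A_t x_t`. -/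
def dichotomySpectrum (A : ℤ → E →L[ℝ] E) : Set ℝ :=
  {γ | 0 < γ ∧ ¬ HasExpDichotomy (fun t => γ⁻¹ • A t)}

/-! ### Fredholm operators of index zero -/

/-- Fredholm operators with index `0`. -/
def IsFredholmIndexZero {X Y : Type*} [NormedAddCommGroup X] [NormedSpace ℝ X]
    [NormedAddCommGroup Y] [NormedSpace ℝ Y] (T : X →L[ℝ] Y) : Prop :=
  T.IsFredholm ∧ Module.finrank ℝ T.ker = Module.finrank ℝ (Y ⧸ T.range)

/-! ### The standing hypotheses on the right-hand side -/

/-- The partial derivative `D₁f_t(x,λ)` of the right-hand side with respect to the state. -/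
def D₁ (f : ℤ → E → ℝ → E) (t : ℤ) (x : E) (lam : ℝ) : E →L[ℝ] E :=
  fderiv ℝ (fun z => f t z lam) x

/-- The standing hypotheses on `x_{t+1} = f_t(x_t,λ)` with `f_t : Ω × Λ → E`. The values of `f_t`
outside of `Ω × Λ` play no role. -/
structure StandingHyp (Ω : Set E) (Λ : Set ℝ) (f : ℤ → E → ℝ → E) : Prop where
  isOpen_param : IsOpen Λ
  ordConnected_param : Λ.OrdConnected
  isOpen_state : IsOpen Ω
  convex_state : Convex ℝ Ω
  zero_mem : (0 : E) ∈ Ω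
  continuousOn : ∀ t, ContinuousOn (fun p : E × ℝ => f t p.1 p.2) (Ω ×ˢ Λ)
  /-- boundedness, uniformly in time -/
  bounded : ∀ K : Set (E × ℝ), IsCompact K →
    ∃ M : ℝ, ∀ t, ∀ p ∈ K ∩ Ω ×ˢ Λ, ‖f t p.1 p.2‖ ≤ M
  /-- uniform continuity on compact sets, uniformly in time -/
  unifCont : ∀ ε > 0, ∀ K : Set (E × ℝ), IsCompact K → ∃ δ > 0,
    ∀ p ∈ K ∩ Ω ×ˢ Λ, ∀ q ∈ K ∩ Ω ×ˢ Λ, max ‖q.1 - p.1‖ |q.2 - p.2| < δ →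
      ∀ t, ‖f t q.1 q.2 - f t p.1 p.2‖ < ε
  /-- existence of the partial derivative -/
  differentiable : ∀ t, ∀ x ∈ Ω, ∀ lam ∈ Λ, DifferentiableAt ℝ (fun z => f t z lam) x
  /-- continuity of the partial derivative -/
  continuousOn_deriv : ∀ t, ContinuousOn (fun p : E × ℝ => D₁ f t p.1 p.2) (Ω ×ˢ Λ)
  /-- boundedness of the partial derivative, uniformly in time -/
  bounded_deriv : ∀ lam ∈ Λ, ∀ B ⊆ Ω, Bornology.IsBounded B →
    ∃ M : ℝ, ∀ t, ∀ x ∈ B, ‖D₁ f t x lam‖ ≤ M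
  /-- uniform continuity of the partial derivative, uniformly in time -/
  unifCont_deriv : ∀ ε > 0, ∀ lam₀ ∈ Λ, ∃ δ > 0,
    ∀ x₁ ∈ Ω, ∀ x₂ ∈ Ω, ∀ lam ∈ Λ, |lam - lam₀| < δ → ‖x₂ - x₁‖ < δ →
      ∀ t, ‖D₁ f t x₂ lam - D₁ f t x₁ lam₀‖ < ε
  /-- the trivial sequence is asymptotically a solution -/
  tendsto_zero : ∀ lam ∈ Λ, Tendsto (fun t => f t 0 lam) (atBot ⊔ atTop) (𝓝 0)

/-! ### Operators on `ℓ₀`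

The Banach space `ℓ₀` of sequences over `ℤ` with two-sided limit `0`, normed by the supremum norm,
is `C₀(ℤ, E)`. -/

/-- The cocompact filter of `ℤ` describes two-sided limits. -/
theorem cocompact_int : cocompact ℤ = (atBot ⊔ atTop : Filter ℤ) := by
  rw [cocompact_eq_cofinite, Int.cofinite_eq]

/-- The left shift `(𝒮φ)_t = φ_{t+1}` on `ℓ₀`. -/
def shift (φ : C₀(ℤ, E)) : C₀(ℤ, E) where
  toFun t := φ (t + 1)
  continuous_toFun := continuous_of_discreteTopology
  zero_at_infty' :=
    (zero_at_infty φ).comp (Homeomorph.addRight (1 : ℤ)).isClosedEmbedding.tendsto_cocompact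

/-- The set `ℓ₀(Ω)` of sequences in `ℓ₀` with values in `Ω`. -/
def l0 (Ω : Set E) : Set C₀(ℤ, E) := {φ | ∀ t, φ t ∈ Ω}

open Classical in
/-- The substitution operator `ℱ(φ,λ)_t = f_t(φ_t,λ)`. On `ℓ₀(Ω) × Λ` its values belong to `ℓ₀`,
see `substitution_apply`; it is set to `0` where this is not the case. -/
def substitution (f : ℤ → E → ℝ → E) (φ : C₀(ℤ, E)) (lam : ℝ) : C₀(ℤ, E) :=
  if h : Tendsto (fun t => f t (φ t) lam) (cocompact ℤ) (𝓝 0) then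
    { toFun := fun t => f t (φ t) lam
      continuous_toFun := continuous_of_discreteTopology
      zero_at_infty' := h }
  else 0

theorem tendsto_substitution [FiniteDimensional ℝ E] {Ω : Set E} {Λ : Set ℝ}
    {f : ℤ → E → ℝ → E} (hf : StandingHyp Ω Λ f) {φ : C₀(ℤ, E)} (hφ : φ ∈ l0 Ω) {lam : ℝ}
    (hlam : lam ∈ Λ) : Tendsto (fun t => f t (φ t) lam) (cocompact ℤ) (𝓝 0) := by
  have : ProperSpace E := FiniteDimensional.proper ℝ E
  have h0 := hf.tendsto_zero lam hlam
  rw [← cocompact_int] at h0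
  have hφ0 : Tendsto φ (cocompact ℤ) (𝓝 0) := zero_at_infty φ
  have hd : Tendsto (fun t => f t (φ t) lam - f t 0 lam) (cocompact ℤ) (𝓝 0) := by
    rw [Metric.tendsto_nhds]
    intro ε hε
    obtain ⟨δ, hδ, H⟩ := hf.unifCont ε hε (Metric.closedBall (0 : E) 1 ×ˢ {lam})
      ((isCompact_closedBall (0 : E) 1).prod isCompact_singleton)
    have h1 := Metric.tendsto_nhds.1 hφ0 (min δ 1) (by positivity)
    filter_upwards [h1] with t ht
    rw [dist_zero_right] at ht ⊢
    have ht1 : ‖φ t‖ ≤ 1 := (ht.trans_le (min_le_right _ _)).le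
    have ht2 : ‖φ t‖ < δ := ht.trans_le (min_le_left _ _)
    exact H (0, lam) ⟨⟨by simp, rfl⟩, hf.zero_mem, hlam⟩ (φ t, lam)
      ⟨⟨by simpa using ht1, rfl⟩, hφ t, hlam⟩ (by simpa [hδ] using ht2) t
  simpa using hd.add h0

theorem substitution_apply [FiniteDimensional ℝ E] {Ω : Set E} {Λ : Set ℝ}
    {f : ℤ → E → ℝ → E} (hf : StandingHyp Ω Λ f) {φ : C₀(ℤ, E)} (hφ : φ ∈ l0 Ω) {lam : ℝ}
    (hlam : lam ∈ Λ) (t : ℤ) : substitution f φ lam t = f t (φ t) lam := by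
  rw [substitution, dif_pos (tendsto_substitution hf hφ hlam)]
  rfl

/-- The operator `𝒢(φ,λ) = 𝒮φ - ℱ(φ,λ)`. -/
def G (f : ℤ → E → ℝ → E) (φ : C₀(ℤ, E)) (lam : ℝ) : C₀(ℤ, E) :=
  shift φ - substitution f φ lam

/-- The partial (Fréchet) derivative `D₁𝒢(φ,λ) ∈ L(ℓ₀)`. -/
def D₁G (f : ℤ → E → ℝ → E) (φ : C₀(ℤ, E)) (lam : ℝ) : C₀(ℤ, E) →L[ℝ] C₀(ℤ, E) :=
  fderiv ℝ (fun ψ => G f ψ lam) φ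

end HomoclinicDE

end

open scoped Topology ZeroAtInfty
open Filter Set

noncomputable section

namespace HomoclinicDE

variable {E : Type*} [NormedAddCommGroup E]

/-! ### Weighted shifts on `ℓ₀` -/

/-! The mean value inequality, with moduli of continuity uniform in time, identifies `D₁G` with the
difference operator `(Lψ)_t = ψ_{t+1} - a_t ψ_t`, `a_t = D₁f_t(φ_t,λ)` (`hasFDerivAt_G`). Since `L =
𝒮(1 - B)` with the shift `𝒮` invertible and `(Bψ)_t = a_{t-1} ψ_{t-1}`, the question is when `1 - B`
is a unit in `L(ℓ₀)`.

A dichotomy splits `B` into a stable part and a part with stable inverse, so two geometric series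
give `(1 - B)⁻¹` (`isUnit_one_sub_of_geometric`). Conversely, `R = (1 - B)⁻¹` applied to impulses
gives Green's function. Its diagonal is the projector (`isInvariantProjector_green`), and
exponential weights give its decay (`exists_green_decay`).

For the Fredholm claims, coefficients along two sequences in `ℓ₀(Ω)` differ by a null sequence, so
the operators differ by a norm limit of finite rank operators (`exists_finiteRank_approx`). Such a
perturbation preserves Fredholmness with index zero, because these operators are exactly invertible
plus finite rank. Invertibility at `φ*` thus passes to index zero at every `φ`. -/

theorem norm_apply_le (ψ : C₀(ℤ, E)) (t : ℤ) : ‖ψ t‖ ≤ ‖ψ‖ :=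
  ψ.toBCF.norm_coe_le_norm t

theorem norm_le_of_forall {ψ : C₀(ℤ, E)} {C : ℝ} (hC : 0 ≤ C) (h : ∀ t, ‖ψ t‖ ≤ C) : ‖ψ‖ ≤ C :=
  (BoundedContinuousFunction.norm_le (f := ψ.toBCF) hC).2 h

/-- A sequence over `ℤ` tending to zero, as an element of `ℓ₀`. -/
def ofTendsto (u : ℤ → E) (h : Tendsto u cofinite (𝓝 0)) : C₀(ℤ, E) where
  toFun := u
  continuous_toFun := continuous_of_discreteTopology
  zero_at_infty' := by rwa [cocompact_eq_cofinite]

@[simp]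
theorem ofTendsto_apply (u : ℤ → E) (h : Tendsto u cofinite (𝓝 0)) (t : ℤ) :
    ofTendsto u h t = u t := rfl

theorem tendsto_cofinite (ψ : C₀(ℤ, E)) : Tendsto ψ cofinite (𝓝 0) := by
  have := zero_at_infty ψ
  rwa [cocompact_eq_cofinite] at this

/-- Setting a sequence in `ℓ₀` to zero outside of a set of times. -/
def restrictTo (p : ℤ → Prop) [DecidablePred p] (ψ : C₀(ℤ, E)) : C₀(ℤ, E) :=
  ofTendsto (fun t => if p t then ψ t else 0) <|
    squeeze_zero_norm (a := fun t => ‖ψ t‖) (fun t => by split_ifs <;> simp)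
      (by simpa using (tendsto_cofinite ψ).norm)

@[simp]
theorem restrictTo_apply (p : ℤ → Prop) [DecidablePred p] (ψ : C₀(ℤ, E)) (t : ℤ) :
    restrictTo p ψ t = if p t then ψ t else 0 := rfl

/-- Together with its limit `0`, the range of `φ` is a compact subset of `Ω`, hence has positive
distance from the complement. This makes `ℓ₀(Ω)` open in the supremum norm. -/
theorem exists_forall_ball_subset {Ω : Set E} {φ : C₀(ℤ, E)} (hΩ : IsOpen Ω)
    (h0 : (0 : E) ∈ Ω) (hφ : φ ∈ l0 Ω) :
    ∃ δ > 0, ∀ t, Metric.ball (φ t) δ ⊆ Ω := by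
  have hK : IsCompact (insert 0 (range φ)) :=
    (tendsto_cofinite φ).isCompact_insert_range_of_cofinite
  obtain ⟨δ, hδ, h⟩ := hK.exists_thickening_subset_open hΩ
    (insert_subset h0 (range_subset_iff.2 hφ))
  exact ⟨δ, hδ, fun t => (Metric.ball_subset_thickening (mem_insert_of_mem _ (mem_range_self t))
    δ).trans h⟩

theorem tendsto_single (s : ℤ) (x : E) :
    Tendsto (Pi.single s x : ℤ → E) cofinite (𝓝 0) := by
  refine tendsto_const_nhds.congr' ?_
  filter_upwards [(Set.finite_singleton s).compl_mem_cofinite] with t ht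
  rw [Pi.single_eq_of_ne (by simpa using ht)]

variable [NormedSpace ℝ E]

/-- Evaluation at `t` on `ℓ₀`. -/
def evalL (t : ℤ) : C₀(ℤ, E) →L[ℝ] E :=
  LinearMap.mkContinuous
    { toFun := fun ψ => ψ t
      map_add' := fun _ _ => rfl
      map_smul' := fun _ _ => rfl } 1 fun ψ => by simpa using norm_apply_le ψ t

@[simp]
theorem evalL_apply (t : ℤ) (ψ : C₀(ℤ, E)) : evalL t ψ = ψ t := rfl

/-- The sequence in `ℓ₀` with value `x` at time `s` and zero elsewhere. -/
def single (s : ℤ) : E →L[ℝ] C₀(ℤ, E) :=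
  LinearMap.mkContinuous
    { toFun := fun x => ofTendsto (Pi.single s x) (tendsto_single s x)
      map_add' := fun x y => by ext t; simp [Pi.single_add]
      map_smul' := fun c x => by ext t; simp [Pi.single_smul] } 1 fun x => by
    refine norm_le_of_forall (by positivity) fun t => ?_
    rcases eq_or_ne t s with rfl | h
    · simp
    · simp [h]

theorem single_apply (s t : ℤ) (x : E) : single s x t = if t = s then x else 0 := by
  change (Pi.single s x : ℤ → E) t = _
  rw [Pi.single_apply]

theorem norm_single_le (s : ℤ) (x : E) : ‖single s x‖ ≤ ‖x‖ := by
  refine norm_le_of_forall (norm_nonneg x) fun t => ?_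
  rw [single_apply]
  split_ifs <;> simp

/-- The weighted shift `(Wψ)_t = a_t ψ_{t+k}` on `ℓ₀`, for a bounded sequence of weights. -/
def weightedShift (a : ℤ → E →L[ℝ] E) (ha : ∃ M, ∀ t, ‖a t‖ ≤ M) (k : ℤ) :
    C₀(ℤ, E) →L[ℝ] C₀(ℤ, E) :=
  LinearMap.mkContinuousOfExistsBound
    { toFun := fun ψ => ofTendsto (fun t => a t (ψ (t + k))) (by
        obtain ⟨M, hM⟩ := ha
        have h : Tendsto (fun t => M * ‖ψ (t + k)‖) cofinite (𝓝 0) := by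
          simpa using (((tendsto_cofinite ψ).comp
            (add_left_injective k).tendsto_cofinite).norm.const_mul M)
        exact squeeze_zero_norm (fun t => (a t).le_of_opNorm_le (hM t) _) h)
      map_add' := fun x y => by ext t; simp
      map_smul' := fun c x => by ext t; simp } (by
    obtain ⟨M, hM⟩ := ha
    have hM0 : 0 ≤ M := (norm_nonneg _).trans (hM 0)
    refine ⟨M, fun ψ => norm_le_of_forall (by positivity) fun t => ?_⟩
    exact (a t).le_of_opNorm_le_of_le (hM t) (norm_apply_le ψ _))

@[simp]
theorem weightedShift_apply (a : ℤ → E →L[ℝ] E) (ha : ∃ M, ∀ t, ‖a t‖ ≤ M) (k : ℤ)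
    (ψ : C₀(ℤ, E)) (t : ℤ) : weightedShift a ha k ψ t = a t (ψ (t + k)) := rfl

theorem norm_weightedShift_le {a : ℤ → E →L[ℝ] E} {M : ℝ} (h : ∀ t, ‖a t‖ ≤ M)
    (ha : ∃ M, ∀ t, ‖a t‖ ≤ M) (k : ℤ) : ‖weightedShift a ha k‖ ≤ M := by
  have hM0 : 0 ≤ M := (norm_nonneg _).trans (h 0)
  refine ContinuousLinearMap.opNorm_le_bound _ hM0 fun ψ => ?_
  exact norm_le_of_forall (by positivity) fun t =>
    (a t).le_of_opNorm_le_of_le (h t) (norm_apply_le ψ _)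

variable (E) in
/-- The left shift on `ℓ₀` as a bounded operator. -/
def shiftL : C₀(ℤ, E) →L[ℝ] C₀(ℤ, E) :=
  weightedShift (fun _ => ContinuousLinearMap.id ℝ E) ⟨_, fun _ => le_rfl⟩ 1

@[simp]
theorem shiftL_apply (ψ : C₀(ℤ, E)) (t : ℤ) : shiftL E ψ t = ψ (t + 1) := rfl

theorem isUnit_shiftL : IsUnit (shiftL E) := by
  let T : C₀(ℤ, E) →L[ℝ] C₀(ℤ, E) :=
    weightedShift (fun _ => ContinuousLinearMap.id ℝ E) ⟨_, fun _ => le_rfl⟩ (-1)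
  refine ⟨⟨shiftL E, T, ?_, ?_⟩, rfl⟩ <;> ext ψ t <;> simp [T]

/-- The operator `(Lψ)_t = ψ_{t+1} - a_t ψ_t` on `ℓ₀`. -/
def differenceOp (a : ℤ → E →L[ℝ] E) (ha : ∃ M, ∀ t, ‖a t‖ ≤ M) : C₀(ℤ, E) →L[ℝ] C₀(ℤ, E) :=
  shiftL E - weightedShift a ha 0

@[simp]
theorem differenceOp_apply (a : ℤ → E →L[ℝ] E) (ha : ∃ M, ∀ t, ‖a t‖ ≤ M) (ψ : C₀(ℤ, E))
    (t : ℤ) : differenceOp a ha ψ t = ψ (t + 1) - a t (ψ t) := by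
  simp [differenceOp]

theorem exists_bound_pred {a : ℤ → E →L[ℝ] E} (ha : ∃ M, ∀ t, ‖a t‖ ≤ M) :
    ∃ M, ∀ t, ‖a (t - 1)‖ ≤ M :=
  ha.imp fun _ h _ => h _

/-- The weighted right shift `(Bψ)_t = a_{t-1} ψ_{t-1}`. -/
def rightShift (a : ℤ → E →L[ℝ] E) (ha : ∃ M, ∀ t, ‖a t‖ ≤ M) : C₀(ℤ, E) →L[ℝ] C₀(ℤ, E) :=
  weightedShift (fun t => a (t - 1)) (exists_bound_pred ha) (-1)

@[simp]
theorem rightShift_apply (a : ℤ → E →L[ℝ] E) (ha : ∃ M, ∀ t, ‖a t‖ ≤ M) (ψ : C₀(ℤ, E))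
    (t : ℤ) : rightShift a ha ψ t = a (t - 1) (ψ (t - 1)) := rfl

theorem differenceOp_eq (a : ℤ → E →L[ℝ] E) (ha : ∃ M, ∀ t, ‖a t‖ ≤ M) :
    differenceOp a ha = shiftL E * (1 - rightShift a ha) := by
  ext ψ t
  simp

theorem isUnit_differenceOp_iff (a : ℤ → E →L[ℝ] E) (ha : ∃ M, ∀ t, ‖a t‖ ≤ M) :
    IsUnit (differenceOp a ha) ↔ IsUnit (1 - rightShift a ha) := by
  rw [differenceOp_eq, isUnit_shiftL.mul_left_iff]

/-! ### Fredholm operators of index zero and finite rank perturbations -/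

section Fredholm

variable {X : Type*} [NormedAddCommGroup X] [NormedSpace ℝ X]

/-- The kernel and the cokernel of a finite rank perturbation of a bijective operator have the
same dimension. -/
theorem finrank_ker_eq_finrank_coker {T F : X →ₗ[ℝ] X} (S : X ≃ₗ[ℝ] X)
    (hT : ∀ x, T x = S x + F x) [FiniteDimensional ℝ (LinearMap.range F)] :
    Module.finrank ℝ (LinearMap.ker T) = Module.finrank ℝ (X ⧸ LinearMap.range T) := by
  set R := LinearMap.range F
  -- `T` maps `X₁ = S⁻¹R` into `R`, its kernel lies in `X₁`, and `R` surjects onto the cokernel with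
  -- kernel `R ∩ range T = T(X₁)`. Rank-nullity for `τ` and `γ`, with `dim X₁ = dim R`, then gives
  -- the claim.
  let X₁ : Submodule ℝ X := R.map S.symm.toLinearMap
  have hX₁ : ∀ x, x ∈ X₁ ↔ S x ∈ R := fun x => by
    constructor
    · rintro ⟨r, hr, rfl⟩
      simpa using hr
    · exact fun h => ⟨S x, h, by simp⟩
  have hdim : Module.finrank ℝ X₁ = Module.finrank ℝ R := LinearEquiv.finrank_map_eq S.symm R
  let τ : X₁ →ₗ[ℝ] X := T.domRestrict X₁
  let γ : R →ₗ[ℝ] X ⧸ LinearMap.range T := (LinearMap.range T).mkQ.comp R.subtype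
  have hγ : LinearMap.range γ = ⊤ := by
    rw [LinearMap.range_eq_top]
    intro q
    obtain ⟨y, rfl⟩ := (LinearMap.range T).mkQ_surjective q
    refine ⟨⟨-F (S.symm y), R.neg_mem ⟨_, rfl⟩⟩, ?_⟩
    change (LinearMap.range T).mkQ (-F (S.symm y)) = _
    rw [← sub_eq_zero, ← map_sub, Submodule.mkQ_apply, Submodule.Quotient.mk_eq_zero]
    refine ⟨-S.symm y, ?_⟩
    rw [map_neg, hT, S.apply_symm_apply]
    abel
  have hker : (LinearMap.ker τ).map X₁.subtype = LinearMap.ker T := by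
    ext x
    simp only [Submodule.mem_map, LinearMap.mem_ker, Submodule.subtype_apply]
    constructor
    · rintro ⟨y, hy, rfl⟩
      exact hy
    · intro hx
      refine ⟨⟨x, (hX₁ x).2 ⟨-x, ?_⟩⟩, hx, rfl⟩
      rw [map_neg, neg_eq_iff_add_eq_zero, add_comm, ← hT, hx]
  have hrange : (LinearMap.ker γ).map R.subtype = LinearMap.range τ := by
    ext y
    simp only [Submodule.mem_map, LinearMap.mem_ker, Submodule.subtype_apply,
      LinearMap.mem_range]
    constructor
    · rintro ⟨r, hr, rfl⟩
      obtain ⟨x, hx⟩ : (r : X) ∈ LinearMap.range T :=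
        (Submodule.Quotient.mk_eq_zero (LinearMap.range T)).1 hr
      refine ⟨⟨x, (hX₁ x).2 ?_⟩, hx⟩
      rw [eq_sub_of_add_eq (hT x).symm, hx]
      exact R.sub_mem r.2 ⟨x, rfl⟩
    · rintro ⟨x, rfl⟩
      have hx : T x ∈ R := by
        rw [hT]
        exact R.add_mem ((hX₁ x).1 x.2) ⟨_, rfl⟩
      exact ⟨⟨T x, hx⟩, (Submodule.Quotient.mk_eq_zero (LinearMap.range T)).2 ⟨x, rfl⟩, rfl⟩
  have : FiniteDimensional ℝ X₁ := inferInstance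
  have h1 := γ.finrank_range_add_finrank_ker
  have h2 := τ.finrank_range_add_finrank_ker
  rw [hγ, finrank_top, ← Submodule.finrank_map_subtype_eq R, hrange] at h1
  rw [← Submodule.finrank_map_subtype_eq X₁, hker] at h2
  omega

/-- A Fredholm operator of index zero is a finite rank perturbation of an invertible operator. -/
theorem IsFredholmIndexZero.exists_eq_add [CompleteSpace X] {T : X →L[ℝ] X}
    (hT : IsFredholmIndexZero T) :
    ∃ S F : X →L[ℝ] X, IsUnit S ∧ FiniteDimensional ℝ F.range ∧ T = S + F := by
  obtain ⟨hfr, hdim⟩ := hT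
  obtain ⟨pkg⟩ := hfr.nonempty_fredholmPackage
  have hk := pkg.ker_eq
  have hr := pkg.range_eq
  obtain ⟨⟨X₀, X₁, hX, fX⟩, ⟨Y₀, Y₁, hY, fY⟩, e, he⟩ := pkg
  dsimp only at hk hr e he
  have hdim' : Module.finrank ℝ X₀ = Module.finrank ℝ Y₀ := by
    rw [← hk, hdim, hr]
    exact (Submodule.quotientEquivOfIsCompl Y₁ Y₀ hY.isCompl).finrank_eq
  -- `X₀` is the kernel of `T` and `Y₀` a complement of its range. Index zero makes them isomorphic,
  -- and adding `j` along `X₀` repairs both defects of `T`.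
  let j : X₀ ≃L[ℝ] Y₀ := ContinuousLinearEquiv.ofFinrankEq hdim'
  let F : X →L[ℝ] X := Y₀.subtypeL ∘L (j : X₀ →L[ℝ] Y₀) ∘L X₀.projectionOntoL X₁ hX.symm
  have hTx : ∀ x, T x = e (X₁.projectionOntoL X₀ hX x) := fun x => by rw [he]; rfl
  have hFx : ∀ x, F x = j (X₀.projectionOntoL X₁ hX.symm x) := fun x => rfl
  refine ⟨T + F, -F, ?_, ?_, by abel⟩
  · rw [ContinuousLinearMap.isUnit_iff_bijective]
    constructor
    · rw [injective_iff_map_eq_zero]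
      intro x hx
      rw [add_apply] at hx
      have h1 : T x ∈ Y₁ := by rw [hTx]; exact Subtype.coe_prop _
      have h2 : F x ∈ Y₀ := by rw [hFx]; exact Subtype.coe_prop _
      have h3 : T x = 0 := Submodule.disjoint_def.1 hY.isCompl.disjoint _ h1 (by
        rw [eq_neg_of_add_eq_zero_left hx]; exact Y₀.neg_mem h2)
      have h4 : F x = 0 := by rwa [h3, zero_add] at hx
      rw [hTx, Submodule.coe_eq_zero, map_eq_zero_iff _ e.injective,
        Submodule.projectionOntoL_apply_eq_zero_iff] at h3
      rw [hFx, Submodule.coe_eq_zero, map_eq_zero_iff _ j.injective,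
        Submodule.projectionOntoL_apply_eq_zero_iff] at h4
      exact Submodule.disjoint_def.1 hX.isCompl.disjoint _ h4 h3
    · intro y
      obtain ⟨u, hu, v, hv, rfl⟩ : ∃ u ∈ Y₁, ∃ v ∈ Y₀, u + v = y :=
        Submodule.mem_sup.1 (hY.isCompl.sup_eq_top ▸ Submodule.mem_top)
      refine ⟨e.symm ⟨u, hu⟩ + j.symm ⟨v, hv⟩, ?_⟩
      rw [add_apply, hTx, hFx]
      simp only [map_add, Submodule.projectionOntoL_apply_left,
        Submodule.projectionOntoL_apply_right]
      simp
  · have : ((-F : X →L[ℝ] X).range) ≤ Y₀ := by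
      rintro _ ⟨x, rfl⟩
      exact Y₀.neg_mem (Subtype.coe_prop _)
    exact Submodule.finiteDimensional_of_le this

open scoped LinearMap.FiniteRangeSetoid in
/-- A finite rank perturbation of an invertible operator is a Fredholm operator of index zero. -/
theorem isFredholmIndexZero_add {S F : X →L[ℝ] X} (hS : IsUnit S)
    [FiniteDimensional ℝ F.range] : IsFredholmIndexZero (S + F) := by
  obtain ⟨u, rfl⟩ := hS
  let e : X ≃L[ℝ] X := ContinuousLinearEquiv.unitsEquiv ℝ X u
  have he : ∀ x, e x = (u : X →L[ℝ] X) x := fun _ => rfl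
  refine ⟨ContinuousLinearMap.IsFredholm.of_isQuasiInverse (v := (e.symm : X →L[ℝ] X)) ?_,
    finrank_ker_eq_finrank_coker (F := F.toLinearMap) e.toLinearEquiv fun x => rfl⟩
  -- `S⁻¹` is a quasi-inverse of `S + F`, since quasi-inverses only see operators modulo finite
  -- rank.
  refine e.toLinearEquiv.isQuasiInverse.congr (Setoid.refl _) ?_
  rw [LinearMap.FiniteRangeSetoid.equiv_iff_hasFiniteRange]
  have h : (u + F : X →L[ℝ] X).toLinearMap - e.toLinearEquiv.toLinearMap = F.toLinearMap := by
    ext x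
    simp [he]
  rw [h]
  exact Submodule.fg_iff_finiteDimensional _ |>.2 inferInstance

theorem IsFredholmIndexZero.of_isUnit {S : X →L[ℝ] X} (hS : IsUnit S) :
    IsFredholmIndexZero S := by
  have : FiniteDimensional ℝ (0 : X →L[ℝ] X).range := by
    rw [ContinuousLinearMap.toLinearMap_zero, LinearMap.range_zero]
    infer_instance
  simpa using isFredholmIndexZero_add (F := 0) hS

theorem finiteDimensional_range_add {F G : X →L[ℝ] X} (hF : FiniteDimensional ℝ F.range)
    (hG : FiniteDimensional ℝ G.range) : FiniteDimensional ℝ (F + G).range := by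
  have : (F + G).range ≤ F.range ⊔ G.range := by
    rintro _ ⟨x, rfl⟩
    exact Submodule.add_mem_sup ⟨x, rfl⟩ ⟨x, rfl⟩
  exact Submodule.finiteDimensional_of_le this

/-- Fredholm operators of index zero are stable under perturbations which can be approximated
by operators of finite rank. -/
theorem IsFredholmIndexZero.add_of_approx [CompleteSpace X] {T C : X →L[ℝ] X}
    (hT : IsFredholmIndexZero T)
    (hC : ∀ ε > 0, ∃ F : X →L[ℝ] X, FiniteDimensional ℝ F.range ∧ ‖C - F‖ < ε) :
    IsFredholmIndexZero (T + C) := by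
  obtain ⟨S, F, hS, hF, rfl⟩ := hT.exists_eq_add
  -- Units are open, so the small remainder `C - F'` is absorbed into `S`, leaving only the finite
  -- rank part `F + F'`.
  obtain ⟨ε, hε, hball⟩ := Metric.isOpen_iff.1 Units.isOpen S hS
  obtain ⟨F', hF', hlt⟩ := hC ε hε
  have hu : IsUnit (S + (C - F')) := hball (by simpa using hlt)
  have := finiteDimensional_range_add hF hF'
  have h := isFredholmIndexZero_add (F := F + F') hu
  rwa [show S + (C - F') + (F + F') = S + F + C by abel] at h

end Fredholm

/-- A multiplication operator on `ℓ₀` with weights tending to zero can be approximated by operators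
of finite rank. -/
theorem exists_finiteRank_approx [FiniteDimensional ℝ E] {c : ℤ → E →L[ℝ] E}
    (hc : ∃ M, ∀ t, ‖c t‖ ≤ M) (h0 : Tendsto c cofinite (𝓝 0)) {ε : ℝ} (hε : 0 < ε) :
    ∃ F : C₀(ℤ, E) →L[ℝ] C₀(ℤ, E), FiniteDimensional ℝ F.range ∧
      ‖weightedShift c hc 0 - F‖ < ε := by
  classical
  -- Truncation to the finitely many times with `‖c_t‖ ≥ ε/2`. The factor `1/2` keeps the inequality
  -- strict after taking the supremum.
  have hfin : {t | ¬ dist (c t) 0 < ε / 2}.Finite :=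
    eventually_cofinite.1 (Metric.tendsto_nhds.1 h0 (ε / 2) (by positivity))
  let s : Finset ℤ := hfin.toFinset
  let c' : ℤ → E →L[ℝ] E := fun t => if t ∈ s then c t else 0
  have hc' : ∃ M, ∀ t, ‖c' t‖ ≤ M := by
    obtain ⟨M, hM⟩ := hc
    refine ⟨M, fun t => ?_⟩
    simp only [c']
    split_ifs
    · exact hM t
    · simpa using (norm_nonneg _).trans (hM t)
  refine ⟨weightedShift c' hc' 0, ?_, ?_⟩
  -- Sequences in the range vanish off `s`, so they are determined by their values on this finite
  -- set.
  · let ev : (weightedShift c' hc' 0).range →ₗ[ℝ] (s → E) :=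
      { toFun := fun w t => (w : C₀(ℤ, E)) t
        map_add' := fun _ _ => rfl
        map_smul' := fun _ _ => rfl }
    refine FiniteDimensional.of_injective ev ?_
    rw [injective_iff_map_eq_zero]
    rintro ⟨_, ψ, rfl⟩ hw
    ext t
    by_cases ht : t ∈ s
    · exact congrFun hw ⟨t, ht⟩
    · change c' t (ψ (t + 0)) = 0
      simp [c', ht]
  · refine lt_of_le_of_lt ?_ (half_lt_self hε)
    refine ContinuousLinearMap.opNorm_le_bound _ (by positivity) fun ψ => ?_
    refine norm_le_of_forall (by positivity) fun t => ?_
    change ‖c t (ψ (t + 0)) - c' t (ψ (t + 0))‖ ≤ _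
    rw [← sub_apply]
    refine (c t - c' t).le_of_opNorm_le_of_le ?_ (norm_apply_le ψ _)
    by_cases ht : t ∈ s
    · simp only [c', ht, if_true, sub_self, norm_zero]
      positivity
    · simp only [c', ht, if_false, sub_zero]
      simp only [s, Set.Finite.mem_toFinset, Set.mem_ofPred_eq, not_not, dist_zero_right] at ht
      exact ht.le

/-- Fredholmness with index zero of difference operators only depends on the behaviour of the
coefficients at infinity. -/
theorem isFredholmIndexZero_differenceOp_of_tendsto [FiniteDimensional ℝ E]
    {a b : ℤ → E →L[ℝ] E} (ha : ∃ M, ∀ t, ‖a t‖ ≤ M) (hb : ∃ M, ∀ t, ‖b t‖ ≤ M)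
    (hab : Tendsto (fun t => a t - b t) cofinite (𝓝 0))
    (h : IsFredholmIndexZero (differenceOp a ha)) : IsFredholmIndexZero (differenceOp b hb) := by
  have : CompleteSpace E := FiniteDimensional.complete ℝ E
  have hc : ∃ M, ∀ t, ‖a t - b t‖ ≤ M := by
    obtain ⟨M, hM⟩ := ha
    obtain ⟨N, hN⟩ := hb
    exact ⟨M + N, fun t => (norm_sub_le _ _).trans (add_le_add (hM t) (hN t))⟩
  have := h.add_of_approx (C := weightedShift _ hc 0) fun ε hε => exists_finiteRank_approx hc hab hε
  convert this using 1
  ext ψ t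
  simp

/-! ### Exponential dichotomies yield invertible difference operators -/

/-- A block triangular inversion: `1 - b` is invertible if `b` is geometrically stable along the
idempotent `p` and has a geometrically stable inverse `c` along `1 - p`. -/
theorem isUnit_one_sub_of_geometric {𝔸 : Type*} [NormedRing 𝔸] [CompleteSpace 𝔸] {b p c : 𝔸}
    (hbp : b * p = p * b) (hbc : b * c = 1 - p) (hcb : c * b = 1 - p) (hpc : p * c = 0)
    (hcp : c * p = 0) {K α : ℝ} (hα0 : 0 ≤ α) (hα1 : α < 1)
    (hb : ∀ n : ℕ, ‖b ^ n * p‖ ≤ K * α ^ n)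
    (hc : ∀ n : ℕ, ‖c ^ (n + 1)‖ ≤ K * α ^ (n + 1)) : IsUnit (1 - b) := by
  have hgeo : Summable fun n : ℕ => K * α ^ n :=
    (summable_geometric_of_lt_one hα0 hα1).mul_left K
  replace hb : Summable fun n : ℕ => b ^ n * p := .of_norm_bounded hgeo hb
  replace hc : Summable fun n : ℕ => c ^ (n + 1) :=
    .of_norm_bounded ((summable_nat_add_iff 1).2 hgeo) hc
  -- The inverse is `r - q`: along `p` it is the Neumann series of `b`, and along `1 - p` one has
  -- `(1 - b)⁻¹ = -c(1 - c)⁻¹ = -∑ c^(n+1)`.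
  set r := ∑' n : ℕ, b ^ n * p with hr
  set q := ∑' n : ℕ, c ^ (n + 1) with hq
  have hr0 : r = p + ∑' n : ℕ, b ^ (n + 1) * p := by
    rw [hr, hb.tsum_eq_zero_add, pow_zero, one_mul]
  have hbr : b * r = r - p := by
    rw [hr, ← hb.tsum_mul_left, ← hr, hr0, add_sub_cancel_left]
    simp_rw [← mul_assoc, ← pow_succ']
  have hrb : r * b = r - p := by
    rw [hr, ← hb.tsum_mul_right, ← hr, hr0, add_sub_cancel_left]
    simp_rw [mul_assoc, ← hbp, ← mul_assoc, ← pow_succ]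
  have hbq : b * q = 1 - p + q := by
    have h : ∀ n : ℕ, b * c ^ (n + 1 + 1) = c ^ (n + 1) := fun n => by
      rw [pow_succ' c (n + 1), ← mul_assoc, hbc, sub_mul, one_mul, pow_succ' c n, ← mul_assoc,
        hpc, zero_mul, sub_zero]
    rw [hq, ← hc.tsum_mul_left, (hc.mul_left b).tsum_eq_zero_add]
    simp only [h, zero_add, pow_one, hbc]
  have hqb : q * b = 1 - p + q := by
    have h : ∀ n : ℕ, c ^ (n + 1 + 1) * b = c ^ (n + 1) := fun n => by
      rw [pow_succ c (n + 1), mul_assoc, hcb, mul_sub, mul_one, pow_succ c n, mul_assoc,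
        hcp, mul_zero, sub_zero]
    rw [hq, ← hc.tsum_mul_right, (hc.mul_right b).tsum_eq_zero_add]
    simp only [h, zero_add, pow_one, hcb]
  refine ⟨⟨1 - b, r - q, ?_, ?_⟩, rfl⟩
  · rw [sub_mul, one_mul, mul_sub, hbr, hbq]
    abel
  · rw [mul_sub, mul_one, sub_mul, hrb, hqb]
    abel

theorem pow_mul_pow_eq_of_mul_eq {R : Type*} [Ring R] {b p c : R} (hbc : b * c = 1 - p)
    (hpc : p * c = 0) (n : ℕ) : b ^ (n + 1) * c ^ (n + 1) = 1 - p := by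
  induction n with
  | zero => simpa using hbc
  | succ n ih =>
    rw [pow_succ, pow_succ' c (n + 1), mul_assoc, ← mul_assoc b c, hbc, sub_mul, one_mul,
      pow_succ' c n, ← mul_assoc p, hpc, zero_mul, sub_zero, ← pow_succ', ih]

/-- This turns dichotomy estimates, which concern evolution operators, into norm bounds for powers
of `B`. -/
theorem rightShift_pow_apply {a : ℤ → E →L[ℝ] E} (ha : ∃ M, ∀ t, ‖a t‖ ≤ M) (n : ℕ)
    (ψ : C₀(ℤ, E)) (s : ℤ) : (rightShift a ha ^ n) ψ (s + n) = evolution a s n (ψ s) := by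
  induction n with
  | zero => simp [evolution]
  | succ n ih =>
    rw [pow_succ', mul_apply_eq_comp, rightShift_apply]
    rw [Nat.cast_succ, ← add_assoc, add_sub_cancel_right, ih]
    rfl

/-- The inverse of `a_t` along the kernels of an invariant projector. -/
theorem IsInvariantProjector.exists_inverse {a P : ℤ → E →L[ℝ] E}
    (hP : IsInvariantProjector a P) {C : ℝ}
    (hC : ∀ t x y, P t x = 0 → a t x = y - P (t + 1) y → ‖x‖ ≤ C * ‖y‖) :
    ∃ c : ℤ → E →L[ℝ] E, (∀ t, ‖c t‖ ≤ |C|) ∧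
      ∀ t y, P t (c t y) = 0 ∧ a t (c t y) = y - P (t + 1) y := by
  have hidem : ∀ t x, P t (P t x) = P t x := fun t x => congr($(hP.idem t) x)
  have hex : ∀ t y, ∃ x, P t x = 0 ∧ a t x = y - P (t + 1) y := fun t y => by
    obtain ⟨x, hx, hax⟩ := (hP.bijOn_ker t).surjOn
      (show P (t + 1) (y - P (t + 1) y) = 0 by rw [map_sub, hidem, sub_self])
    exact ⟨x, hx, hax⟩
  choose c hc0 hc using hex
  have huniq : ∀ t x x', P t x = 0 → P t x' = 0 → a t x = a t x' → x = x' :=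
    fun t x x' hx hx' h => (hP.bijOn_ker t).injOn hx hx' h
  refine ⟨fun t => LinearMap.mkContinuous
    { toFun := c t
      map_add' := fun x y => huniq t _ _ (hc0 _ _) (by simp [hc0]) (by
        simp only [map_add, hc]; abel)
      map_smul' := fun r x => huniq t _ _ (hc0 _ _) (by simp [hc0]) (by
        simp only [map_smul, hc, smul_sub, RingHom.id_apply]) } |C| fun y =>
        (hC t _ y (hc0 t y) (hc t y)).trans
          (mul_le_mul_of_nonneg_right (le_abs_self C) (norm_nonneg y)),
    fun t => LinearMap.mkContinuous_norm_le _ (abs_nonneg C) _, fun t y => ⟨hc0 t y, hc t y⟩⟩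

/-- An exponential dichotomy on `ℤ` makes the difference operator invertible on `ℓ₀`. -/
theorem HasExpDichotomy.isUnit_one_sub_rightShift [CompleteSpace E] {a : ℤ → E →L[ℝ] E}
    (h : HasExpDichotomy a) (ha : ∃ M, ∀ t, ‖a t‖ ≤ M) : IsUnit (1 - rightShift a ha) := by
  obtain ⟨P, hP, K, α, hK, hα0, hα1, hst, hun⟩ := h
  have hK0 : 0 ≤ K := zero_le_one.trans hK
  -- The second dichotomy estimate with `n = 1` bounds the one-step inverses uniformly in time.
  obtain ⟨c, hcb, hc⟩ := hP.exists_inverse (C := K * α ^ 1) fun t x y hx hxy =>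
    hun t 1 x y hx (by simpa [evolution] using hxy)
  have hidem : ∀ t x, P t (P t x) = P t x := fun t x => congr($(hP.idem t) x)
  have hcomm : ∀ t x, P (t + 1) (a t x) = a t (P t x) := fun t x => congr($(hP.comm t) x)
  have huniq : ∀ t x x', P t x = 0 → P t x' = 0 → a t x = a t x' → x = x' :=
    fun t x x' hx hx' h => (hP.bijOn_ker t).injOn hx hx' h
  have hPb : ∃ M, ∀ t, ‖P t‖ ≤ M :=
    ⟨K, fun t => by simpa [evolution, ContinuousLinearMap.id_comp] using hst t 0⟩
  obtain ⟨B, hB⟩ : ∃ B, B = rightShift a ha := ⟨_, rfl⟩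
  obtain ⟨Q, hQa⟩ : ∃ Q : C₀(ℤ, E) →L[ℝ] C₀(ℤ, E), ∀ ψ t, Q ψ t = P t (ψ t) :=
    ⟨weightedShift P hPb 0, fun ψ t => by simp⟩
  obtain ⟨C, hCa⟩ : ∃ C : C₀(ℤ, E) →L[ℝ] C₀(ℤ, E), ∀ ψ t, C ψ t = c t (ψ (t + 1)) :=
    ⟨weightedShift c ⟨_, hcb⟩ 1, fun ψ t => rfl⟩
  have hBa : ∀ ψ t, B ψ t = a (t - 1) (ψ (t - 1)) := fun ψ t => by rw [hB, rightShift_apply]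
  rw [← hB]
  have hcomm' : ∀ t x, P t (a (t - 1) x) = a (t - 1) (P (t - 1) x) := fun t x => by
    simpa using hcomm (t - 1) x
  have hBQ : B * Q = Q * B := by
    ext ψ t
    simp [hQa, hBa, hcomm']
  have hBC : B * C = 1 - Q := by
    ext ψ t
    simp [hQa, hBa, hCa, (hc _ _).2]
  have hCB : C * B = 1 - Q := by
    ext ψ t
    simp only [mul_apply_eq_comp, hCa, hBa, add_sub_cancel_right, sub_apply,
      one_apply_eq_self, ZeroAtInftyContinuousMap.sub_apply, hQa]
    exact huniq t _ _ (hc _ _).1 (by simp [hidem]) (by simp [(hc _ _).2, hcomm])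
  have hQC : Q * C = 0 := by
    ext ψ t
    simp [hQa, hCa, (hc _ _).1]
  have hCQ : C * Q = 0 := by
    ext ψ t
    simp only [mul_apply_eq_comp, hCa, hQa, zero_apply,
      ZeroAtInftyContinuousMap.zero_apply]
    exact huniq t _ _ (hc _ _).1 (map_zero _) (by simp [(hc _ _).2, hidem])
  refine isUnit_one_sub_of_geometric (𝔸 := C₀(ℤ, E) →L[ℝ] C₀(ℤ, E)) (K := K) hBQ hBC hCB hQC hCQ
    hα0.le hα1 (fun n => ?_) (fun n => ?_)
  · refine ContinuousLinearMap.opNorm_le_bound _ (by positivity) fun ψ => ?_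
    refine norm_le_of_forall (by positivity) fun t => ?_
    obtain ⟨s, rfl⟩ : ∃ s : ℤ, t = s + n := ⟨t - n, by ring⟩
    rw [mul_apply_eq_comp, hB, rightShift_pow_apply, hQa]
    exact ((evolution a s n).comp (P s)).le_of_opNorm_le_of_le (hst s n) (norm_apply_le ψ s)
  · have hpow := pow_mul_pow_eq_of_mul_eq hBC hQC n
    refine ContinuousLinearMap.opNorm_le_bound _ (by positivity) fun ψ => ?_
    refine norm_le_of_forall (by positivity) fun s => ?_
    -- `(C^(n+1) ψ)_s` is the backward continuation of `(I - P)ψ_{s+n+1}` within the kernels: `QC =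
    -- 0` puts it in `N(P_s)` and `B^(n+1) C^(n+1) = 1 - Q` gives its forward image.
    refine (hun s (n + 1) _ (ψ (s + (n + 1 : ℕ))) ?_ ?_).trans
      (mul_le_mul_of_nonneg_left (norm_apply_le ψ _) (by positivity))
    · rw [← hQa, ← mul_apply_eq_comp, pow_succ', ← mul_assoc, hQC]
      simp
    · rw [← rightShift_pow_apply ha, ← hB, ← mul_apply_eq_comp, hpow]
      simp [hQa]

/-! ### Invertible difference operators yield exponential dichotomies -/

theorem IsInvariantProjector.evolution_mem_ker {a P : ℤ → E →L[ℝ] E}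
    (hP : IsInvariantProjector a P) {s : ℤ} {x : E} (hx : P s x = 0) (n : ℕ) :
    P (s + n) (evolution a s n x) = 0 := by
  induction n with
  | zero => simpa [evolution] using hx
  | succ n ih =>
    rw [Nat.cast_succ, ← add_assoc]
    exact (hP.bijOn_ker (s + n)).mapsTo ih

theorem IsInvariantProjector.eq_zero_of_evolution_eq_zero {a P : ℤ → E →L[ℝ] E}
    (hP : IsInvariantProjector a P) {s : ℤ} {x : E} (hx : P s x = 0) {n : ℕ}
    (h : evolution a s n x = 0) : x = 0 := by
  induction n with
  | zero => simpa [evolution] using h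
  | succ n ih =>
    refine ih ((hP.bijOn_ker (s + n)).injOn (hP.evolution_mem_ker hx n) (map_zero _) ?_)
    rw [map_zero]
    exact h

theorem evolution_apply_eq {a : ℤ → E →L[ℝ] E} {u : ℤ → E} {s : ℤ} {n : ℕ}
    (h : ∀ m : ℕ, m < n → u (s + m + 1) = a (s + m) (u (s + m))) :
    evolution a s n (u s) = u (s + n) := by
  induction n with
  | zero => simp [evolution]
  | succ n ih =>
    rw [Nat.cast_succ, ← add_assoc, h n n.lt_succ_self,
      ← ih fun m hm => h m (hm.trans n.lt_succ_self)]
    rfl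

/-! ### Green's function: algebra, projector and exponential decay -/

section Green

variable {a : ℤ → E →L[ℝ] E} {ha : ∃ M, ∀ t, ‖a t‖ ≤ M} {R : C₀(ℤ, E) →L[ℝ] C₀(ℤ, E)}

theorem green_rec (hR : (1 - rightShift a ha) * R = 1) (s t : ℤ) (x : E) :
    R (single s x) t = a (t - 1) (R (single s x) (t - 1)) + if t = s then x else 0 := by
  have h := congr($hR (single s x) t)
  simp only [mul_apply_eq_comp, sub_apply, one_apply_eq_self, ZeroAtInftyContinuousMap.sub_apply,
    rightShift_apply, single_apply] at h
  rw [← h]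
  abel

/-- Uniqueness of the `ℓ₀` solution with an impulse at time `s`. All identities for Green's function
below rest on exhibiting a sequence with the right recursion. -/
theorem green_eq_of_rec (hL : R * (1 - rightShift a ha) = 1) {s : ℤ} {y : E} {u : C₀(ℤ, E)}
    (h : ∀ t, u t = a (t - 1) (u (t - 1)) + if t = s then y else 0) : R (single s y) = u := by
  have h1 : single s y = (1 - rightShift a ha) u := by
    ext t
    simp only [sub_apply, one_apply_eq_self, ZeroAtInftyContinuousMap.sub_apply,
      rightShift_apply, single_apply]
    rw [h t]
    abel
  rw [h1, ← mul_apply_eq_comp, hL, one_apply_eq_self]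

theorem green_succ (hR : (1 - rightShift a ha) * R = 1) {s t : ℤ} (h : t + 1 ≠ s) (x : E) :
    R (single s x) (t + 1) = a t (R (single s x) t) := by
  rw [green_rec hR, if_neg h, add_zero, add_sub_cancel_right]

/-- The forward part of a Green's function is a Green's function. -/
theorem green_forward (hR : (1 - rightShift a ha) * R = 1) (hL : R * (1 - rightShift a ha) = 1)
    (s : ℤ) (x : E) :
    R (single s (R (single s x) s)) = restrictTo (s ≤ ·) (R (single s x)) := by
  -- Cutting off the past creates a single impulse, the jump from `0` to `R (single s x) s` at time
  -- `s`.
  refine green_eq_of_rec hL fun t => ?_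
  simp only [restrictTo_apply]
  rcases lt_trichotomy t s with h | rfl | h
  · simp [h.not_ge, show ¬ s ≤ t - 1 by omega, h.ne]
  · simp
  · rw [if_pos h.le, if_pos (by omega), if_neg h.ne', green_rec hR s t, if_neg h.ne']

/-- The backward part of a Green's function is a Green's function. -/
theorem green_backward (hR : (1 - rightShift a ha) * R = 1)
    (hL : R * (1 - rightShift a ha) = 1) {r s : ℤ} (hrs : r < s) (x : E) :
    R (single r (-(R (single s x) r))) = restrictTo (· < r) (R (single s x)) := by
  -- For `u = R (single s x)`, the cut forces the value `0` at `r` in place of `a_{r-1} u_{r-1} =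
  -- u_r`, that is, an impulse `-u_r`. The original impulse at `s > r` is cut away.
  refine green_eq_of_rec hL fun t => ?_
  simp only [restrictTo_apply]
  rcases lt_trichotomy t r with h | rfl | h
  · rw [if_pos h, if_pos (by omega), if_neg h.ne, green_rec hR s t, if_neg (by omega)]
  · rw [if_neg (lt_irrefl _), if_pos (by omega), if_pos rfl, green_rec hR s t,
      if_neg (by omega), add_zero, add_neg_cancel]
  · simp [h.not_gt, h.ne', show ¬ t - 1 < r by omega]

/-- Removing `x` at time `s` cancels the impulse there; the missing contribution `a_s x` becomes an
impulse at `s + 1`. -/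
theorem green_coeff (hR : (1 - rightShift a ha) * R = 1) (hL : R * (1 - rightShift a ha) = 1)
    (s : ℤ) (x : E) : R (single (s + 1) (a s x)) = R (single s x) - single s x := by
  refine green_eq_of_rec hL fun t => ?_
  simp only [ZeroAtInftyContinuousMap.sub_apply, single_apply, map_sub]
  rw [green_rec hR s t]
  by_cases h : t = s + 1
  · subst h
    simp
  · simp [h, show ¬ t - 1 = s by omega]

theorem green_coeff_apply (hR : (1 - rightShift a ha) * R = 1)
    (hL : R * (1 - rightShift a ha) = 1) (s : ℤ) (x : E) :
    R (single (s + 1) (a s x)) (s + 1) = a s (R (single s x) s) := by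
  rw [green_coeff hR hL, ZeroAtInftyContinuousMap.sub_apply, single_apply, if_neg (by omega),
    sub_zero, green_succ hR (by omega)]

/-- The projector given by the diagonal of Green's function. -/
theorem isInvariantProjector_green (hR : (1 - rightShift a ha) * R = 1)
    (hL : R * (1 - rightShift a ha) = 1) :
    IsInvariantProjector a fun s => (evalL s).comp (R.comp (single s)) where
  idem s := by
    ext x
    simp [green_forward hR hL]
  comm s := by
    ext x
    exact green_coeff_apply hR hL s x
  bijOn_ker s := by
    refine ⟨fun x (hx : R (single s x) s = 0) => ?_, ?_, ?_⟩
    · change R (single (s + 1) (a s x)) (s + 1) = 0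
      rw [green_coeff_apply hR hL, hx, map_zero]
    · intro x (hx : R (single s x) s = 0) y (hy : R (single s y) s = 0) hxy
      have h := green_coeff hR hL s (x - y)
      rw [map_sub (a s), hxy, sub_self, map_zero, map_zero] at h
      have h1 := congr($h s)
      simpa [single_apply, hx, hy, eq_comm, sub_eq_zero] using h1
    · intro y (hy : R (single (s + 1) y) (s + 1) = 0)
      -- Green's function `u` with impulse `y` at `s + 1` vanishes there, so `0 = a_s u_s + y` and
      -- `-u_s` is a preimage of `y`.
      refine ⟨-(R (single (s + 1) y) s), ?_, ?_⟩
      · change R (single s (-(R (single (s + 1) y) s))) s = 0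
        rw [green_backward hR hL (by omega)]
        simp
      · have h := green_rec hR (s + 1) (s + 1) y
        rw [hy, if_pos rfl, add_sub_cancel_right] at h
        rw [map_neg, neg_eq_iff_add_eq_zero, h]

/-- Conjugation by the weight `ρ^|t-s|` perturbs `B` by an operator `D` whose size is uniform in `s`
and small for `ρ` near `1`, so the weighted equation stays solvable. As the weighted Green's
function is not known to lie in `ℓ₀` beforehand, a solution `g` is constructed first; dividing by
the weight and uniqueness recover Green's function. -/
theorem exists_green_decay [CompleteSpace E] (hR : (1 - rightShift a ha) * R = 1)
    (hL : R * (1 - rightShift a ha) = 1) :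
    ∃ K α : ℝ, 0 ≤ K ∧ 0 < α ∧ α < 1 ∧
      ∀ s t x, ‖R (single s x) t‖ ≤ K * α ^ (t - s).natAbs * ‖x‖ := by
  obtain ⟨M, hM⟩ := ha
  have hM0 : 0 ≤ M := (norm_nonneg _).trans (hM 0)
  -- The bound `1/2` makes `1 - R D` invertible and gives `‖g‖ ≤ 2‖R‖‖x‖`.
  obtain ⟨η, hη, hsmall⟩ : ∃ η : ℝ, 0 < η ∧ ‖R‖ * (η * M) ≤ 1 / 2 := by
    refine ⟨1 / (2 * (‖R‖ * M + 1)), by positivity, ?_⟩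
    rw [div_mul_eq_mul_div, one_mul, mul_div_assoc', div_le_iff₀ (by positivity)]
    nlinarith [mul_nonneg (norm_nonneg R) hM0]
  set ρ : ℝ := 1 + η with hρ
  have hρ0 : 0 < ρ := by positivity
  have hρ1 : 1 < ρ := by linarith
  refine ⟨2 * ‖R‖, ρ⁻¹, by positivity, by positivity, inv_lt_one_of_one_lt₀ hρ1,
    fun s t x => ?_⟩
  let w : ℤ → ℝ := fun t => ρ ^ (t - s).natAbs
  have hw : ∀ t, 0 < w t := fun t => by positivity
  have hw1 : ∀ t, 1 ≤ w t := fun t => one_le_pow₀ hρ1.le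
  have hratio : ∀ t, |w (t + 1) / w t - 1| ≤ η := fun t => by
    rcases le_or_gt s t with h | h
    · have : w (t + 1) = w t * ρ := by
        simp only [w]
        rw [← pow_succ]
        congr 1
        omega
      rw [this, mul_div_cancel_left₀ _ (hw t).ne', hρ, add_sub_cancel_left, abs_of_pos hη]
    · have : w t = w (t + 1) * ρ := by
        simp only [w]
        rw [← pow_succ]
        congr 1
        omega
      rw [this, div_mul_cancel_left₀ (hw _).ne', abs_sub_comm,
        abs_of_nonneg (sub_nonneg.2 (inv_lt_one_of_one_lt₀ hρ1).le), sub_le_iff_le_add,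
        ← sub_le_iff_le_add', hρ, ← one_div, le_div_iff₀ (by positivity)]
      nlinarith
  have hdb : ∀ t, ‖(w (t + 1) / w t - 1) • a t‖ ≤ η * M := fun t => by
    rw [norm_smul, Real.norm_eq_abs]
    exact mul_le_mul (hratio t) (hM t) (norm_nonneg _) hη.le
  let D : C₀(ℤ, E) →L[ℝ] C₀(ℤ, E) := rightShift (fun t => (w (t + 1) / w t - 1) • a t) ⟨_, hdb⟩
  have hD : ‖D‖ ≤ η * M := norm_weightedShift_le (fun t => hdb (t - 1)) _ _
  have hRD : ‖R * D‖ ≤ 1 / 2 :=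
    (ContinuousLinearMap.opNorm_comp_le R D).trans ((mul_le_mul_of_nonneg_left hD (norm_nonneg R)).trans hsmall)
  obtain ⟨V, hV⟩ : ∃ V, (1 - R * D) * V = 1 :=
    (isUnit_one_sub_of_norm_lt_one (R := C₀(ℤ, E) →L[ℝ] C₀(ℤ, E)) (hRD.trans_lt (by norm_num))).exists_right_inv
  -- Equivalently `(1 - B - D) g = single s x`, where `B + D` has the coefficients `(w_{t+1}/w_t)
  -- a_t`.
  obtain ⟨g, hg⟩ : ∃ g, g = R (single s x + D g) := by
    refine ⟨V (R (single s x)), ?_⟩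
    have := congr($hV (R (single s x)))
    simp only [mul_apply_eq_comp, sub_apply, one_apply_eq_self] at this
    rw [map_add, ← sub_eq_iff_eq_add, this]
  have hgn : ‖g‖ ≤ 2 * ‖R‖ * ‖x‖ := by
    have h1 : ‖g‖ ≤ ‖R‖ * ‖x‖ + 1 / 2 * ‖g‖ := by
      calc ‖g‖ = ‖R (single s x) + (R * D) g‖ := by rw [mul_apply_eq_comp, ← map_add, ← hg]
        _ ≤ _ := (norm_add_le _ _).trans (add_le_add
          (R.le_opNorm_of_le (norm_single_le s x)) ((R * D).le_of_opNorm_le hRD g))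
    linarith
  have hgrec : ∀ t, g t = (w t / w (t - 1)) • a (t - 1) (g (t - 1)) + if t = s then x else 0 := by
    intro t
    have h := congr((1 - rightShift a ⟨M, hM⟩) $hg t)
    rw [← mul_apply_eq_comp, hR] at h
    simp only [sub_apply, one_apply_eq_self, ZeroAtInftyContinuousMap.sub_apply,
      ZeroAtInftyContinuousMap.add_apply, rightShift_apply, single_apply, D,
      sub_add_cancel, smul_apply, sub_smul, one_smul] at h
    rw [sub_eq_iff_eq_add] at h
    rw [h]
    abel
  let W : ℤ → E →L[ℝ] E := fun t => (w t)⁻¹ • ContinuousLinearMap.id ℝ E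
  have hW : ∀ t, ‖W t‖ ≤ 1 := fun t => by
    refine ContinuousLinearMap.opNorm_le_bound _ zero_le_one fun y => ?_
    simp only [W, smul_apply, ContinuousLinearMap.id_apply]
    rw [norm_smul, Real.norm_of_nonneg (inv_nonneg.2 (hw t).le)]
    exact mul_le_mul_of_nonneg_right (inv_le_one_of_one_le₀ (hw1 t)) (norm_nonneg _)
  have hu : R (single s x) = weightedShift W ⟨_, hW⟩ 0 g := by
    refine green_eq_of_rec hL fun t => ?_
    simp only [weightedShift_apply, add_zero, W, smul_apply,
      ContinuousLinearMap.id_apply, map_smul]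
    rw [hgrec t, smul_add, smul_smul, ← mul_div_assoc, inv_mul_cancel₀ (hw t).ne', one_div]
    congr 1
    split_ifs with h
    · subst h
      simp [w]
    · simp
  rw [hu, weightedShift_apply, add_zero]
  simp only [W, smul_apply, ContinuousLinearMap.id_apply]
  rw [norm_smul, Real.norm_of_nonneg (inv_nonneg.2 (hw t).le), inv_pow]
  calc (w t)⁻¹ * ‖g t‖ ≤ (w t)⁻¹ * (2 * ‖R‖ * ‖x‖) :=
        mul_le_mul_of_nonneg_left ((norm_apply_le g t).trans hgn) (inv_nonneg.2 (hw t).le)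
    _ = _ := by simp only [w]; ring

end Green

/-- An invertible difference operator yields an exponential dichotomy. -/
theorem hasExpDichotomy_of_isUnit [CompleteSpace E] {a : ℤ → E →L[ℝ] E}
    (ha : ∃ M, ∀ t, ‖a t‖ ≤ M) (h : IsUnit (1 - rightShift a ha)) : HasExpDichotomy a := by
  obtain ⟨R, hR, hL⟩ := isUnit_iff_exists.1 h
  obtain ⟨K, α, hK, hα0, hα1, hdecay⟩ := exists_green_decay hR hL
  have hP := isInvariantProjector_green hR hL
  have hPa : ∀ s x, ((evalL s).comp (R.comp (single s)) : E →L[ℝ] E) x = R (single s x) s :=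
    fun _ _ => rfl
  -- The extra `1` serves the second estimate at `n = 0`, where `x = y - P_s y`; it also ensures
  -- that the constant is at least `1`.
  refine ⟨_, hP, K + 1, α, by linarith, hα0, hα1, fun s n => ?_, fun s n x y hx hxy => ?_⟩
  · refine ContinuousLinearMap.opNorm_le_bound _ (by positivity) fun x => ?_
    rw [ContinuousLinearMap.comp_apply, hPa,
      evolution_apply_eq (u := R (single s x)) fun m _ => green_succ hR (by omega) x]
    refine (hdecay s (s + n) x).trans ?_
    rw [show (s + n - s).natAbs = n by omega]
    gcongr
    linarith
  · rw [hPa] at hx hxy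
    rcases n with _ | n
    · have hx' : x = y - R (single s y) s := by simpa [evolution] using hxy
      have h1 := hdecay s s y
      simp only [sub_self, Int.natAbs_zero, pow_zero, mul_one] at h1 ⊢
      rw [hx']
      refine (norm_sub_le _ _).trans ?_
      linarith
    · set r : ℤ := s + (n + 1 : ℕ) with hr
      -- With `u` the Green's function for the impulse `y` at `r`, the vector `-u_s` lies in
      -- `N(P_s)` and evolves to `-a_{r-1} u_{r-1} = y - u_r = y - P_r y`. Injectivity on the kernel
      -- forces `x = -u_s`, and `u` decays.
      have hker : R (single s (-(R (single r y) s))) s = 0 := by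
        rw [green_backward hR hL (by omega)]
        simp
      have hev : evolution a s (n + 1) (-(R (single r y) s)) = y - R (single r y) r := by
        have h1 : evolution a s (n + 1) (R (single r y) s) =
            a (s + n) (evolution a s n (R (single r y) s)) := rfl
        rw [map_neg, h1, evolution_apply_eq fun m hm => green_succ hR (by omega) y,
          green_rec hR r r, if_pos rfl, show r - 1 = s + n by rw [hr]; push_cast; ring]
        abel
      have hx' : x - -(R (single r y) s) = 0 :=
        hP.eq_zero_of_evolution_eq_zero (s := s) (n := n + 1)
          (by rw [map_sub, hPa, hPa, hx, hker, sub_zero]) (by rw [map_sub, hxy, hev, sub_self])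
      rw [sub_eq_zero.1 hx', norm_neg]
      refine (hdecay r s y).trans ?_
      rw [show (s - r).natAbs = n + 1 by omega]
      gcongr
      linarith

theorem isUnit_differenceOp_iff_hasExpDichotomy [CompleteSpace E] (a : ℤ → E →L[ℝ] E)
    (ha : ∃ M, ∀ t, ‖a t‖ ≤ M) : IsUnit (differenceOp a ha) ↔ HasExpDichotomy a := by
  rw [isUnit_differenceOp_iff]
  exact ⟨hasExpDichotomy_of_isUnit ha, fun h => h.isUnit_one_sub_rightShift ha⟩

/-! ### The derivative of `𝒢` -/

section Derivative

variable {Ω : Set E} {Λ : Set ℝ} {f : ℤ → E → ℝ → E} {φ : C₀(ℤ, E)} {lam : ℝ}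

theorem StandingHyp.exists_bound_D₁ (hf : StandingHyp Ω Λ f) (hφ : φ ∈ l0 Ω) (hlam : lam ∈ Λ) :
    ∃ M, ∀ t, ‖D₁ f t (φ t) lam‖ ≤ M := by
  obtain ⟨M, hM⟩ := hf.bounded_deriv lam hlam (range φ) (range_subset_iff.2 hφ)
    (ZeroAtInftyContinuousMap.isBounded_range φ)
  exact ⟨M, fun t => hM t _ (mem_range_self t)⟩

theorem hasFDerivAt_G [FiniteDimensional ℝ E] (hf : StandingHyp Ω Λ f) (hφ : φ ∈ l0 Ω)
    (hlam : lam ∈ Λ) :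
    HasFDerivAt (fun ψ => G f ψ lam)
      (differenceOp (fun t => D₁ f t (φ t) lam) (hf.exists_bound_D₁ hφ hlam)) φ := by
  rw [hasFDerivAt_iff_isLittleO, Asymptotics.isLittleO_iff]
  intro ε hε
  obtain ⟨r, hr, hball⟩ := exists_forall_ball_subset hf.isOpen_state hf.zero_mem hφ
  obtain ⟨δ, hδ, H⟩ := hf.unifCont_deriv ε hε lam hlam
  filter_upwards [Metric.ball_mem_nhds φ (lt_min hr hδ)] with ψ hψ
  rw [Metric.mem_ball, dist_eq_norm, lt_min_iff] at hψ
  have hlt : ∀ t, ‖ψ t - φ t‖ ≤ ‖ψ - φ‖ := fun t => norm_apply_le (ψ - φ) t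
  have hψΩ : ψ ∈ l0 Ω := fun t => hball t (by
    rw [Metric.mem_ball, dist_eq_norm]
    exact (hlt t).trans_lt hψ.1)
  refine norm_le_of_forall (by positivity) fun t => ?_
  -- The mean value inequality on the convex set `Ω ∩ ball (φ t) δ`. As `δ` does not depend on `t`,
  -- the remainder is controlled in the supremum norm.
  have hmv := Convex.norm_image_sub_le_of_norm_hasFDerivWithin_le' (𝕜 := ℝ)
    (f := fun z => f t z lam) (f' := fun z => D₁ f t z lam) (φ := D₁ f t (φ t) lam) (C := ε)
    (s := Ω ∩ Metric.ball (φ t) δ) (x := φ t) (y := ψ t)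
    (fun z hz => (hf.differentiable t z hz.1 lam hlam).hasFDerivAt.hasFDerivWithinAt)
    (fun z hz => (H _ (hφ t) z hz.1 lam hlam (by simpa using hδ)
      (by simpa [dist_eq_norm] using hz.2) t).le)
    (hf.convex_state.inter (convex_ball _ _)) ⟨hφ t, Metric.mem_ball_self hδ⟩
    ⟨hψΩ t, by rw [Metric.mem_ball, dist_eq_norm]; exact (hlt t).trans_lt hψ.2⟩
  have hG : ∀ χ ∈ l0 Ω, G f χ lam t = χ (t + 1) - f t (χ t) lam := fun χ hχ => by
    rw [G, ZeroAtInftyContinuousMap.sub_apply, substitution_apply hf hχ hlam]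
    rfl
  simp only [ZeroAtInftyContinuousMap.sub_apply, hG _ hφ, hG _ hψΩ, differenceOp_apply]
  rw [show ψ (t + 1) - f t (ψ t) lam - (φ (t + 1) - f t (φ t) lam) -
      (ψ (t + 1) - φ (t + 1) - D₁ f t (φ t) lam (ψ t - φ t)) =
      -(f t (ψ t) lam - f t (φ t) lam - D₁ f t (φ t) lam (ψ t - φ t)) by abel, norm_neg]
  exact hmv.trans (mul_le_mul_of_nonneg_left (hlt t) hε.le)

theorem D₁G_eq [FiniteDimensional ℝ E] (hf : StandingHyp Ω Λ f) (hφ : φ ∈ l0 Ω)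
    (hlam : lam ∈ Λ) :
    D₁G f φ lam =
      differenceOp (fun t => D₁ f t (φ t) lam) (hf.exists_bound_D₁ hφ hlam) :=
  (hasFDerivAt_G hf hφ hlam).fderiv

/-- Along two sequences in `ℓ₀(Ω)` the partial derivatives of the right-hand side are asymptotic. -/
theorem StandingHyp.tendsto_D₁_sub (hf : StandingHyp Ω Λ f) {ψ : C₀(ℤ, E)} (hφ : φ ∈ l0 Ω)
    (hψ : ψ ∈ l0 Ω) (hlam : lam ∈ Λ) :
    Tendsto (fun t => D₁ f t (φ t) lam - D₁ f t (ψ t) lam) cofinite (𝓝 0) := by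
  rw [Metric.tendsto_nhds]
  intro ε hε
  obtain ⟨δ, hδ, H⟩ := hf.unifCont_deriv ε hε lam hlam
  filter_upwards [Metric.tendsto_nhds.1 (tendsto_cofinite (φ - ψ)) δ hδ] with t ht
  rw [dist_zero_right] at ht ⊢
  exact H _ (hψ t) _ (hφ t) lam hlam (by simpa using hδ) ht t

theorem isFredholmIndexZero_D₁G_of [FiniteDimensional ℝ E] (hf : StandingHyp Ω Λ f)
    {ψ : C₀(ℤ, E)} (hφ : φ ∈ l0 Ω) (hψ : ψ ∈ l0 Ω) (hlam : lam ∈ Λ)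
    (h : IsFredholmIndexZero (D₁G f φ lam)) : IsFredholmIndexZero (D₁G f ψ lam) := by
  rw [D₁G_eq hf hφ hlam] at h
  rw [D₁G_eq hf hψ hlam]
  exact isFredholmIndexZero_differenceOp_of_tendsto _ _ (hf.tendsto_D₁_sub hφ hψ hlam) h

theorem isUnit_D₁G_iff [FiniteDimensional ℝ E] (hf : StandingHyp Ω Λ f) (hφ : φ ∈ l0 Ω)
    (hlam : lam ∈ Λ) :
    IsUnit (D₁G f φ lam) ↔ (1 : ℝ) ∉ dichotomySpectrum fun t => D₁ f t (φ t) lam := by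
  have : CompleteSpace E := FiniteDimensional.complete ℝ E
  rw [D₁G_eq hf hφ hlam, isUnit_differenceOp_iff_hasExpDichotomy]
  simp [dichotomySpectrum]

end Derivative

end HomoclinicDE

end

theorem mainTheorem3 {E : Type*} [NormedAddCommGroup E] [NormedSpace ℝ E] [FiniteDimensional ℝ E]
    (Ω : Set E) (Λ : Set ℝ) (f : ℤ → E → ℝ → E) (hf : HomoclinicDE.StandingHyp Ω Λ f)
    (lamStar : ℝ) (hlamStar : lamStar ∈ Λ)
    (φStar : ZeroAtInftyContinuousMap ℤ E) (hφStar : φStar ∈ HomoclinicDE.l0 Ω)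
    (hsol : ∀ t : ℤ, φStar (t + 1) = f t (φStar t) lamStar) :
    -- the derivative in question exists and is the expected operator
    (∀ φ ∈ HomoclinicDE.l0 Ω, ∀ lam ∈ Λ,
      DifferentiableAt ℝ (fun ψ => HomoclinicDE.G f ψ lam) φ ∧
      ∀ (ψ : ZeroAtInftyContinuousMap ℤ E) (t : ℤ),
        HomoclinicDE.D₁G f φ lam ψ t = ψ (t + 1) - HomoclinicDE.D₁ f t (φ t) lam (ψ t)) ∧
    -- invertibility
    (IsUnit (HomoclinicDE.D₁G f φStar lamStar) ↔
      (1 : ℝ) ∉ HomoclinicDE.dichotomySpectrum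
        (fun t => HomoclinicDE.D₁ f t (φStar t) lamStar)) ∧
    -- Fredholmness at the reference parameter
    ((1 : ℝ) ∉ HomoclinicDE.dichotomySpectrum
        (fun t => HomoclinicDE.D₁ f t (φStar t) lamStar) →
      ∀ φ ∈ HomoclinicDE.l0 Ω,
        HomoclinicDE.IsFredholmIndexZero (HomoclinicDE.D₁G f φ lamStar)) ∧
    -- transfer of Fredholmness
    (∀ φ ∈ HomoclinicDE.l0 Ω, ∀ lam ∈ Λ,
      (HomoclinicDE.IsFredholmIndexZero (HomoclinicDE.D₁G f φStar lam) ↔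
        HomoclinicDE.IsFredholmIndexZero (HomoclinicDE.D₁G f φ lam))) := by
  refine ⟨fun φ hφ lam hlam => ⟨(HomoclinicDE.hasFDerivAt_G hf hφ hlam).differentiableAt,
    fun ψ t => ?_⟩, HomoclinicDE.isUnit_D₁G_iff hf hφStar hlamStar, fun h φ hφ => ?_,
    fun φ hφ lam hlam => ⟨HomoclinicDE.isFredholmIndexZero_D₁G_of hf hφStar hφ hlam,
      HomoclinicDE.isFredholmIndexZero_D₁G_of hf hφ hφStar hlam⟩⟩
  · rw [HomoclinicDE.D₁G_eq hf hφ hlam, HomoclinicDE.differenceOp_apply]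
  · exact HomoclinicDE.isFredholmIndexZero_D₁G_of hf hφStar hφ hlamStar
      (.of_isUnit ((HomoclinicDE.isUnit_D₁G_iff hf hφStar hlamStar).2 h))
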